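/- Let $n\ge 2$, $s_1,s_2\in(0,1)$, $\lambda\ge 1$ and $\varrho\in(0,\infty]$. For $i=1,2$ let $K_i\colon\mathbb{R}^n\setminus\{0\}\to[0,+\infty)$ be measurable and even, with $$\frac{\chi_{B_\varrho}(\zeta)}{\lambda|\zeta|^{n+s_i}}\le K_i(\zeta)\le\frac{\lambda}{|\zeta|^{n+s_i}}\qquad\text{for all }\zeta\in\mathbb{R}^n\setminus\{0\},$$ where $B_\varrho$ is the open ball of radius $\varrho$ centred at the origin ($B_\infty=\mathbb{R}^n$). For measurable disjoint $E,F\subseteq\mathbb{R}^n$ put $$I_i(E,F):=\int_E\int_F K_i(x-y)\,dx\,dy\in[0,+\infty],$$ and write $E^c:=\mathbb{R}^n\setminus E$. Let $\Omega\subseteq\mathbb{R}^n$ be open and bounded with $I_1(\Omega,\Omega^c)+I_2(\Omega,\Omega^c)<+\infty$, and let $m\in(0,|\Omega|)$, $g\in L^\infty(\Omega)$ and $\sigma\in\mathbb{R}$. For measurable $E\subseteq\Omega$ define $$\mathcal{C}(E):=I_1(E,E^c\cap\Omega)+\sigma\,I_2(E,\Omega^c)+\int_E g(x)\,dx\in(-\infty,+\infty].$$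 Then $\mathcal{C}$ has a minimizer among all measurable sets $E\subseteq\Omega$ with Lebesgue measure $|E|=m$. Moreover, every such minimizer $E$ satisfies $I_1(E,E^c\cap\Omega)<+\infty$. -/

import Mathlib

open MeasureTheory Set
open scoped ENNReal

noncomputable section

namespace NonlocalCapillarity

/-- The class `K(n, s, lam, rho)` of interaction kernels. A kernel is a function on `ℝⁿ ∖ {0}`; it is
represented by a function on all of `ℝⁿ` whose value at the origin is arbitrary. Measurability is
in the sense of Lebesgue. The ball `B_rho` is `{ζ | ‖ζ‖ₑ < rho}`, which is all of `ℝⁿ` when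
`rho = ∞`; outside `B_rho` the lower bound is just nonnegativity. -/
structure IsKernel (n : ℕ) (s lam : ℝ) (rho : ℝ≥0∞)
    (K : EuclideanSpace ℝ (Fin n) → ℝ) : Prop where
  aemeasurable : AEMeasurable K volume
  even : ∀ ζ, ζ ≠ 0 → K (-ζ) = K ζ
  nonneg : ∀ ζ, ζ ≠ 0 → 0 ≤ K ζ
  lower : ∀ ζ, ζ ≠ 0 → ‖ζ‖ₑ < rho → 1 / (lam * ‖ζ‖ ^ ((n : ℝ) + s)) ≤ K ζ
  upper : ∀ ζ, ζ ≠ 0 → K ζ ≤ lam / ‖ζ‖ ^ ((n : ℝ) + s)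

/-- The interaction `I_K(E, F) = ∫_E ∫_F K(x - y) dx dy ∈ [0, ∞]`. -/
def interaction {n : ℕ} (K : EuclideanSpace ℝ (Fin n) → ℝ)
    (E F : Set (EuclideanSpace ℝ (Fin n))) : ℝ≥0∞ :=
  ∫⁻ x in E, ∫⁻ y in F, ENNReal.ofReal (K (x - y))

/-- The surface energy `I₁(E, Eᶜ ∩ Ω) + σ I₂(E, Ωᶜ)`, with values in the extended reals. When
`I₂(Ω, Ωᶜ) < ∞` and `E ⊆ Ω`, the second term is a real number, so that the sum never has the
indeterminate form `∞ - ∞`. -/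
def energy {n : ℕ} (K₁ K₂ : EuclideanSpace ℝ (Fin n) → ℝ) (Ω : Set (EuclideanSpace ℝ (Fin n)))
    (σ : ℝ) (E : Set (EuclideanSpace ℝ (Fin n))) : EReal :=
  (interaction K₁ E (Eᶜ ∩ Ω) : EReal) + (σ : EReal) * (interaction K₂ E Ωᶜ : EReal)

/-- The capillarity functional: the surface energy plus `∫_E g`. -/
def capillarity {n : ℕ} (K₁ K₂ : EuclideanSpace ℝ (Fin n) → ℝ)
    (Ω : Set (EuclideanSpace ℝ (Fin n))) (σ : ℝ) (g : EuclideanSpace ℝ (Fin n) → ℝ)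
    (E : Set (EuclideanSpace ℝ (Fin n))) : EReal :=
  energy K₁ K₂ Ω σ E + ((∫ x in E, g x : ℝ) : EReal)

/-- The competitors: Lebesgue measurable subsets of `Ω` with Lebesgue measure `m`. -/
def competitors {n : ℕ} (Ω : Set (EuclideanSpace ℝ (Fin n))) (m : ℝ) :
    Set (Set (EuclideanSpace ℝ (Fin n))) :=
  {E | NullMeasurableSet E volume ∧ E ⊆ Ω ∧ volume E = ENNReal.ofReal m}

/-- `E` minimizes the capillarity functional among the subsets of `Ω` with Lebesgue measure `m`. -/
def IsMinimizer {n : ℕ} (K₁ K₂ : EuclideanSpace ℝ (Fin n) → ℝ)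
    (Ω : Set (EuclideanSpace ℝ (Fin n))) (σ : ℝ) (g : EuclideanSpace ℝ (Fin n) → ℝ) (m : ℝ)
    (E : Set (EuclideanSpace ℝ (Fin n))) : Prop :=
  E ∈ competitors Ω m ∧
    ∀ F ∈ competitors Ω m, capillarity K₁ K₂ Ω σ g E ≤ capillarity K₁ K₂ Ω σ g F

end NonlocalCapillarity

end

open Filter Topology

namespace NonlocalCapillarity

variable {n : ℕ} {s lam : ℝ} {rho : ℝ≥0∞} {K : EuclideanSpace ℝ (Fin n) → ℝ}

/-! The proof is the direct method. Finiteness of `I₂(Ω, Ωᶜ)` and integrability of `g` bound the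
wetting and potential terms uniformly over subsets of `Ω`, so a minimizing sequence has bounded
`I₁(E, Eᶜ ∩ Ω)`. Adding `I₁(Ω, Ωᶜ)` bounds the full nonlocal perimeters.

Compactness (`IsKernel.exists_subseq_ae_eventually_mem_or`) comes from comparing sets on small
balls. Near the origin the kernel is at least a multiple of `|ζ|^(-n-s)`, so replacing a
characteristic function by its averages at scale `δ` costs only `O(δ^s)` in `L¹`, uniformly along
the sequence. Averages over countably many balls converge along a diagonal subsequence. Hence the
sets are Cauchy in measure, and a further subsequence converges almost everywhere.

Along it, Fatou's lemma makes `I₁` lower semicontinuous (`interaction_le_liminf`), while dominated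
convergence passes the volume, wetting and potential terms to the limit. The infimum is finite
because `Ω` cut by a suitable ball is a competitor of finite energy; comparison with it also gives
the last claim. -/

/-! ### Interactions: symmetry, monotonicity and limits -/

lemma aemeasurable_kernel_sub (hK : AEMeasurable K volume) :
    AEMeasurable (fun p : EuclideanSpace ℝ (Fin n) × EuclideanSpace ℝ (Fin n) =>
      ENNReal.ofReal (K (p.1 - p.2))) (volume.prod volume) :=
  (hK.comp_quasiMeasurePreserving
    (quasiMeasurePreserving_sub_of_right_invariant volume volume)).ennreal_ofReal

lemma interaction_eq_lintegral_prod (hK : AEMeasurable K volume)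
    (E F : Set (EuclideanSpace ℝ (Fin n))) :
    interaction K E F
      = ∫⁻ p in E ×ˢ F, ENNReal.ofReal (K (p.1 - p.2)) ∂(volume.prod volume) := by
  rw [← Measure.prod_restrict, lintegral_prod]
  · rfl
  · rw [Measure.prod_restrict]
    exact (aemeasurable_kernel_sub hK).restrict

lemma interaction_eq_lintegral_indicator (hK : AEMeasurable K volume)
    {E F : Set (EuclideanSpace ℝ (Fin n))} (hE : NullMeasurableSet E volume)
    (hF : NullMeasurableSet F volume) :
    interaction K E F
      = ∫⁻ p, (E ×ˢ F).indicator (fun p => ENNReal.ofReal (K (p.1 - p.2))) p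
          ∂(volume.prod volume) := by
  rw [interaction_eq_lintegral_prod hK, lintegral_indicator₀ (hE.prod hF)]

lemma interaction_mono (hK : AEMeasurable K volume) {E F E' F' : Set (EuclideanSpace ℝ (Fin n))}
    (hE : E ⊆ E') (hF : F ⊆ F') : interaction K E F ≤ interaction K E' F' := by
  rw [interaction_eq_lintegral_prod hK, interaction_eq_lintegral_prod hK]
  exact lintegral_mono_set (prod_mono hE hF)

lemma interaction_union_right_le (hK : AEMeasurable K volume)
    (E F G : Set (EuclideanSpace ℝ (Fin n))) :
    interaction K E (F ∪ G) ≤ interaction K E F + interaction K E G := by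
  simp only [interaction_eq_lintegral_prod hK, prod_union]
  exact lintegral_union_le _ _ _

lemma IsKernel.interaction_comm [NeZero n] (hK : IsKernel n s lam rho K)
    (E F : Set (EuclideanSpace ℝ (Fin n))) : interaction K E F = interaction K F E := by
  unfold interaction
  rw [lintegral_lintegral_swap]
  · refine lintegral_congr fun x => lintegral_congr_ae (ae_restrict_of_ae ?_)
    filter_upwards [Measure.ae_ne volume x] with y hy
    rw [← hK.even (x - y) (sub_ne_zero.2 hy.symm), neg_sub]
  · rw [Measure.prod_restrict]
    exact (aemeasurable_kernel_sub hK.aemeasurable).restrict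

/-- Lower semicontinuity of the interaction under almost everywhere convergence of sets. -/
lemma interaction_le_liminf (hK : AEMeasurable K volume)
    {E F : ℕ → Set (EuclideanSpace ℝ (Fin n))} {E' F' : Set (EuclideanSpace ℝ (Fin n))}
    (hE : ∀ k, NullMeasurableSet (E k) volume) (hF : ∀ k, NullMeasurableSet (F k) volume)
    (hE' : NullMeasurableSet E' volume) (hF' : NullMeasurableSet F' volume)
    (hEE : ∀ᵐ x, x ∈ E' → ∀ᶠ k in atTop, x ∈ E k)
    (hFF : ∀ᵐ x, x ∈ F' → ∀ᶠ k in atTop, x ∈ F k) :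
    interaction K E' F' ≤ liminf (fun k => interaction K (E k) (F k)) atTop := by
  simp only [fun k => interaction_eq_lintegral_indicator hK (hE k) (hF k),
    interaction_eq_lintegral_indicator hK hE' hF']
  refine (lintegral_mono_ae ?_).trans
    (lintegral_liminf_le' fun k => (aemeasurable_kernel_sub hK).indicator₀ ((hE k).prod (hF k)))
  filter_upwards [Measure.quasiMeasurePreserving_fst.ae hEE,
    Measure.quasiMeasurePreserving_snd.ae hFF] with p hp hp'
  by_cases h : p ∈ E' ×ˢ F'
  · refine le_liminf_of_le (by isBoundedDefault) ?_
    filter_upwards [hp h.1, hp' h.2] with k hk hk'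
    rw [indicator_of_mem h, indicator_of_mem (mk_mem_prod hk hk')]
  · rw [indicator_of_notMem h]
    exact zero_le

/-- Continuity of the interaction with a fixed set under dominated almost everywhere convergence
of sets. -/
lemma tendsto_interaction_left (hK : AEMeasurable K volume)
    {E : ℕ → Set (EuclideanSpace ℝ (Fin n))} {E' Ω F : Set (EuclideanSpace ℝ (Fin n))}
    (hE : ∀ k, NullMeasurableSet (E k) volume) (hE' : NullMeasurableSet E' volume)
    (hF : NullMeasurableSet F volume) (hΩ : NullMeasurableSet Ω volume)
    (hfin : interaction K Ω F ≠ ∞) (hEΩ : ∀ k, E k ⊆ Ω)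
    (hEE : ∀ᵐ x, ∀ᶠ k in atTop, x ∈ E k ↔ x ∈ E') :
    Tendsto (fun k => interaction K (E k) F) atTop (𝓝 (interaction K E' F)) := by
  rw [interaction_eq_lintegral_indicator hK hΩ hF] at hfin
  simp only [fun k => interaction_eq_lintegral_indicator hK (hE k) hF,
    interaction_eq_lintegral_indicator hK hE' hF]
  refine tendsto_lintegral_of_dominated_convergence' _
    (fun k => (aemeasurable_kernel_sub hK).indicator₀ ((hE k).prod hF)) (fun k => ?_) hfin ?_
  · exact .of_forall fun p => indicator_le_indicator_of_subset (prod_mono (hEΩ k) Subset.rfl)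
      (fun _ => zero_le) p
  · filter_upwards [Measure.quasiMeasurePreserving_fst.ae hEE] with p hp
    refine tendsto_const_nhds.congr' ?_
    filter_upwards [hp] with k hk
    by_cases h : p ∈ E' ×ˢ F
    · rw [indicator_of_mem h, indicator_of_mem (mk_mem_prod (hk.2 h.1) h.2)]
    · rw [indicator_of_notMem h, indicator_of_notMem fun h' => h ⟨hk.1 h'.1, h'.2⟩]

/-! ### A competitor of finite energy -/

open Metric in
lemma volume_ball_diff_ball_le [NeZero n] {r d : ℝ} (hr : 0 ≤ r) (hd : 0 ≤ d) :
    volume (ball (0 : EuclideanSpace ℝ (Fin n)) r \ ball 0 (r - d))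
      ≤ ENNReal.ofReal (d * n * r ^ (n - 1)) * volume (ball (0 : EuclideanSpace ℝ (Fin n)) 1) := by
  set t := max (r - d) 0
  have ht : t ≤ r := max_le (by linarith) hr
  have hball : ball (0 : EuclideanSpace ℝ (Fin n)) (r - d) = ball 0 t := by
    rcases le_total (r - d) 0 with h | h
    · rw [ball_eq_empty.2 h, ball_eq_empty.2 (max_le h le_rfl)]
    · simp only [t, max_eq_left h]
  rw [hball, measure_sdiff (ball_subset_ball ht) measurableSet_ball.nullMeasurableSet
    measure_ball_lt_top.ne, Measure.addHaar_ball _ _ hr, Measure.addHaar_ball _ _ (le_max_right _ _),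
    finrank_euclideanSpace_fin, ← ENNReal.sub_mul fun _ _ => measure_ball_lt_top.ne,
    ← ENNReal.ofReal_sub _ (by positivity)]
  gcongr
  refine (le_abs_self _).trans ((abs_pow_sub_pow_le _ _ _).trans ?_)
  rw [abs_of_nonneg hr, abs_of_nonneg (show 0 ≤ t from le_max_right _ _), max_eq_left ht,
    abs_of_nonneg (sub_nonneg.2 ht)]
  gcongr
  have : r - d ≤ t := le_max_left _ _
  linarith

/-- In polar coordinates the integrand becomes `y ^ (n - 1) * y ^ (1 - n - s) = y ^ (-s)`,
integrable at the origin since `s < 1`. -/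
lemma lintegral_ball_norm_rpow_lt_top [NeZero n] (hs : s < 1) (r : ℝ) :
    ∫⁻ z in Metric.ball (0 : EuclideanSpace ℝ (Fin n)) r, ENNReal.ofReal (‖z‖ ^ (1 - n - s)) < ∞ := by
  have hn : 1 ≤ n := NeZero.one_le
  have h : IntegrableOn (fun z : EuclideanSpace ℝ (Fin n) => ‖z‖ ^ (1 - n - s))
      (Metric.ball 0 r) volume := by
    rw [integrableOn_fun_norm_addHaar volume (f := fun y : ℝ => y ^ (1 - n - s)),
      finrank_euclideanSpace_fin]
    rcases le_or_gt r 0 with hr | hr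
    · simp [Ioo_eq_empty (not_lt.2 hr)]
    refine ((intervalIntegral.integrableOn_Ioo_rpow_iff (s := -s) hr).2 (by linarith)).congr_fun
      (fun y hy => ?_) measurableSet_Ioo
    have hy0 : 0 < y := hy.1
    simp only [smul_eq_mul]
    rw [← Real.rpow_natCast, ← Real.rpow_add hy0, Nat.cast_sub hn]
    congr 1
    push_cast
    ring
  exact h.lintegral_lt_top

lemma ofReal_rpow_add_mul {t : ℝ} (ht : 0 < t) (hlam : 0 ≤ lam) :
    ENNReal.ofReal (lam / t ^ ((n : ℝ) + s)) * ENNReal.ofReal t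
      = ENNReal.ofReal lam * ENNReal.ofReal (t ^ (1 - n - s)) := by
  rw [← ENNReal.ofReal_mul (by positivity), ← ENNReal.ofReal_mul hlam]
  congr 1
  rw [div_mul_eq_mul_div, mul_div_assoc]
  congr 1
  rw [show (1 : ℝ) - n - s = 1 - (n + s) by ring, Real.rpow_sub ht, Real.rpow_one]

open Metric in
/-- Balls have finite fractional perimeter relative to any larger ball. -/
lemma IsKernel.interaction_ball_lt_top [NeZero n] (hK : IsKernel n s lam rho K) (hs : s < 1)
    (hlam : 0 ≤ lam) {r R : ℝ} (hr : 0 ≤ r) :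
    interaction K (ball 0 r) (ball 0 R \ ball 0 r) < ∞ := by
  let k : EuclideanSpace ℝ (Fin n) → ℝ≥0∞ := fun z => ENNReal.ofReal (lam / ‖z‖ ^ ((n : ℝ) + s))
  have hk : Measurable k := by unfold k; fun_prop
  -- In the variables `x` and `z = x - y`, these are the pairs with `x` in the small ball and `y` in
  -- the annulus. For fixed `z`, such `x` lie in a shell of thickness `‖z‖` inside the sphere of
  -- radius `r`. The shell has volume `O(‖z‖)`, which improves the singularity of the kernel by one
  -- power.
  let A : Set (EuclideanSpace ℝ (Fin n) × EuclideanSpace ℝ (Fin n)) :=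
    {p | p.1 ∈ ball 0 r ∧ p.1 - p.2 ∈ ball 0 R \ ball 0 r}
  have hA : MeasurableSet A := by
    refine (measurable_fst measurableSet_ball).inter ?_
    exact (measurable_fst.sub measurable_snd) (measurableSet_ball.diff measurableSet_ball)
  have h1 : interaction K (ball 0 r) (ball 0 R \ ball 0 r)
      ≤ ∫⁻ x, ∫⁻ z, A.indicator (fun p => k p.2) (x, z) := by
    unfold interaction
    rw [← lintegral_indicator measurableSet_ball]
    refine lintegral_mono fun x => ?_
    by_cases hx : x ∈ ball 0 r
    · rw [indicator_of_mem hx, ← lintegral_indicator (measurableSet_ball.diff measurableSet_ball),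
        ← lintegral_sub_left_eq_self _ x]
      refine lintegral_mono fun z => ?_
      by_cases hz : x - z ∈ ball 0 R \ ball 0 r
      · rw [indicator_of_mem hz, indicator_of_mem (show (x, z) ∈ A from ⟨hx, hz⟩), sub_sub_cancel]
        refine ENNReal.ofReal_le_ofReal (hK.upper z ?_)
        rintro rfl
        exact hz.2 (by simpa using hx)
      · rw [indicator_of_notMem hz]
        exact zero_le
    · rw [indicator_of_notMem hx]
      exact zero_le
  set v := volume (ball (0 : EuclideanSpace ℝ (Fin n)) 1)
  have h2 : ∀ z, ∫⁻ x, A.indicator (fun p => k p.2) (x, z)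
      ≤ (ball (0 : EuclideanSpace ℝ (Fin n)) (r + R)).indicator (fun z =>
        ENNReal.ofReal lam * ENNReal.ofReal (n * r ^ (n - 1)) * v *
          ENNReal.ofReal (‖z‖ ^ (1 - n - s))) z := by
    intro z
    by_cases hz : z ∈ ball 0 (r + R) ∧ z ≠ 0
    · rw [indicator_of_mem hz.1]
      calc ∫⁻ x, A.indicator (fun p => k p.2) (x, z)
          ≤ ∫⁻ x, (ball (0 : EuclideanSpace ℝ (Fin n)) r \ ball 0 (r - ‖z‖)).indicator
              (fun _ => k z) x := by
            refine lintegral_mono fun x => ?_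
            by_cases hx : (x, z) ∈ A
            · rw [indicator_of_mem hx, indicator_of_mem]
              refine ⟨hx.1, fun hx' => hx.2.2 ?_⟩
              simp only [mem_ball_zero_iff] at hx' ⊢
              linarith [norm_sub_le x z]
            · rw [indicator_of_notMem hx]
              exact zero_le
        _ = k z * volume (ball (0 : EuclideanSpace ℝ (Fin n)) r \ ball 0 (r - ‖z‖)) := by
            rw [lintegral_indicator (measurableSet_ball.diff measurableSet_ball),
              setLIntegral_const]
        _ ≤ k z * (ENNReal.ofReal (‖z‖ * n * r ^ (n - 1)) * v) := by
            gcongr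
            exact volume_ball_diff_ball_le hr (norm_nonneg z)
        _ = (k z * ENNReal.ofReal ‖z‖) * ENNReal.ofReal (n * r ^ (n - 1)) * v := by
            rw [mul_assoc ‖z‖, ENNReal.ofReal_mul (norm_nonneg z)]
            ring
        _ = _ := by
            rw [ofReal_rpow_add_mul (norm_pos_iff.2 hz.2) hlam]
            ring
    · have : ∀ x, A.indicator (fun p => k p.2) (x, z) = 0 := by
        refine fun x => indicator_of_notMem (fun hx => hz ⟨?_, ?_⟩) _
        · have h1 := hx.1
          have h2 := hx.2.1
          simp only [mem_ball_zero_iff] at h1 h2 ⊢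
          have := norm_sub_le x (x - z)
          rw [sub_sub_cancel] at this
          linarith
        · rintro rfl
          exact hx.2.2 (by simpa using hx.1)
      simp [this]
  refine h1.trans_lt ?_
  rw [lintegral_lintegral_swap]
  · refine (lintegral_mono h2).trans_lt ?_
    rw [lintegral_indicator measurableSet_ball, lintegral_const_mul _ (by fun_prop)]
    exact ENNReal.mul_lt_top (ENNReal.mul_lt_top (ENNReal.mul_lt_top ENNReal.ofReal_lt_top
      ENNReal.ofReal_lt_top) measure_ball_lt_top) (lintegral_ball_norm_rpow_lt_top hs _)
  · exact ((hk.comp measurable_snd).indicator hA).aemeasurable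

open Metric in
/-- A bounded set has a subset of prescribed volume that is cut out by a ball. -/
lemma exists_volume_inter_ball_eq [NeZero n] {Ω : Set (EuclideanSpace ℝ (Fin n))} {R : ℝ}
    (hR : 0 ≤ R) (hΩR : Ω ⊆ ball 0 R) {m : ℝ} (hm0 : 0 ≤ m) (hm : ENNReal.ofReal m ≤ volume Ω) :
    ∃ r, 0 ≤ r ∧ volume (Ω ∩ ball 0 r) = ENNReal.ofReal m := by
  set v := volume.real (ball (0 : EuclideanSpace ℝ (Fin n)) 1)
  have hfin : ∀ r, volume (Ω ∩ ball 0 r) ≠ ∞ := fun r =>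
    measure_ne_top_of_subset inter_subset_right measure_ball_lt_top.ne
  have hC : 0 ≤ n * R ^ (n - 1) * v := by positivity
  have hlip : LipschitzOnWith (n * R ^ (n - 1) * v).toNNReal
      (fun r => volume.real (Ω ∩ ball 0 r)) (Icc 0 R) := by
    refine LipschitzOnWith.of_le_add_mul _ fun r hr r' hr' => ?_
    rw [Real.coe_toNNReal _ hC, Real.dist_eq]
    -- This inclusion holds for either order of `r` and `r'`, so the one-sided estimate suffices for
    -- the Lipschitz bound.
    have hsub : Ω ∩ ball 0 r
        ⊆ (Ω ∩ ball 0 r') ∪ (ball (0 : EuclideanSpace ℝ (Fin n)) r \ ball 0 (r - |r - r'|)) := by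
      intro x hx
      by_cases hx' : x ∈ ball 0 (r - |r - r'|)
      · exact Or.inl ⟨hx.1, ball_subset_ball (by linarith [le_abs_self (r - r')]) hx'⟩
      · exact Or.inr ⟨hx.2, hx'⟩
    have hdiff : volume (ball (0 : EuclideanSpace ℝ (Fin n)) r \ ball 0 (r - |r - r'|)) ≠ ∞ :=
      measure_ne_top_of_subset sdiff_subset measure_ball_lt_top.ne
    refine (measureReal_mono hsub (measure_union_ne_top (hfin _) hdiff)).trans
      ((measureReal_union_le _ _).trans (add_le_add_right ?_ _))
    refine (ENNReal.toReal_mono (ENNReal.mul_ne_top ENNReal.ofReal_ne_top measure_ball_lt_top.ne)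
      (volume_ball_diff_ball_le hr.1 (abs_nonneg (r - r')))).trans ?_
    rw [ENNReal.toReal_mul, ENNReal.toReal_ofReal
      (mul_nonneg (by positivity) (pow_nonneg hr.1 _)), ← Measure.real, mul_right_comm _ v,
      mul_comm _ |r - r'|, ← mul_assoc]
    have := pow_le_pow_left₀ hr.1 hr.2 (n - 1)
    gcongr
  have hΩ : volume Ω = volume (Ω ∩ ball 0 R) := by rw [inter_eq_left.2 hΩR]
  obtain ⟨r, hr, hrm⟩ := intermediate_value_Icc hR hlip.continuousOn
    (show m ∈ Icc _ _ from ⟨by simpa using hm0, by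
      rw [hΩ] at hm
      exact (ENNReal.ofReal_le_iff_le_toReal (hfin R)).1 hm⟩)
  exact ⟨r, hr.1, by rw [← hrm, ofReal_measureReal (hfin r)]⟩

/-! ### Compactness under a bound on nonlocal perimeters -/

/-- A sequence of sets that is Cauchy in measure has a subsequence that converges almost
everywhere. -/
lemma exists_subseq_ae_eventually_mem_or {α : Type*} [MeasurableSpace α] {μ : Measure α}
    {E : ℕ → Set α}
    (h : ∀ ε : ℝ≥0∞, ε ≠ 0 → ∃ N, ∀ k ≥ N, ∀ l ≥ N, μ (symmDiff (E k) (E l)) ≤ ε) :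
    ∃ φ : ℕ → ℕ, StrictMono φ ∧
      ∀ᵐ x ∂μ, (∀ᶠ k in atTop, x ∈ E (φ k)) ∨ (∀ᶠ k in atTop, x ∉ E (φ k)) := by
  obtain ⟨φ, hφ, hφE⟩ := extraction_forall_of_eventually'
    (P := fun j N => ∀ k ≥ N, ∀ l ≥ N, μ (symmDiff (E k) (E l)) ≤ 2⁻¹ ^ j) fun j => by
      obtain ⟨N, hN⟩ := h (2⁻¹ ^ j) (pow_ne_zero _ (by simp))
      exact ⟨N, fun M hM k hk l hl => hN k (hM.trans hk) l (hM.trans hl)⟩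
  refine ⟨φ, hφ, ?_⟩
  -- By Borel–Cantelli, almost every point lies in only finitely many consecutive symmetric
  -- differences, so its membership stabilizes.
  have hsum : ∑' j, μ (symmDiff (E (φ j)) (E (φ (j + 1)))) ≠ ∞ := by
    refine ne_top_of_le_ne_top ?_
      (ENNReal.tsum_le_tsum fun j => hφE j _ le_rfl _ (hφ (Nat.lt_succ_self j)).le)
    rw [ENNReal.tsum_geometric]
    simp
  filter_upwards [ae_eventually_notMem hsum] with x hx
  obtain ⟨N, hN⟩ := eventually_atTop.1 hx
  have hiff : ∀ k ≥ N, x ∈ E (φ k) ↔ x ∈ E (φ N) := by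
    intro k hk
    induction k, hk using Nat.le_induction with
    | base => rfl
    | succ k hk ih =>
      rw [← ih]
      have := hN k hk
      rw [mem_symmDiff] at this
      tauto
  by_cases hxN : x ∈ E (φ N)
  · exact Or.inl (eventually_atTop.2 ⟨N, fun k hk => (hiff k hk).2 hxN⟩)
  · exact Or.inr (eventually_atTop.2 ⟨N, fun k hk => fun h => hxN ((hiff k hk).1 h)⟩)

/-- The least admissible index works. Using only countably many centres makes functions of the
centre measurable and leaves countably many balls for the diagonal extraction. -/
lemma exists_measurable_dist_denseSeq_lt (X : Type*) [PseudoMetricSpace X]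
    [TopologicalSpace.SeparableSpace X] [Nonempty X] [MeasurableSpace X] [OpensMeasurableSpace X]
    {δ : ℝ} (hδ : 0 < δ) :
    ∃ i : X → ℕ, Measurable i ∧ ∀ x, dist x (TopologicalSpace.denseSeq X (i x)) < δ := by
  classical
  have h : ∀ x, ∃ N, dist x (TopologicalSpace.denseSeq X N) < δ := fun x =>
    (TopologicalSpace.denseRange_denseSeq X).exists_dist_lt x hδ
  exact ⟨fun x => Nat.find (h x), measurable_find h fun N =>
    measurableSet_lt (continuous_id.dist continuous_const).measurable measurable_const,
    fun x => Nat.find_spec (h x)⟩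

lemma IsKernel.one_le_mul (hK : IsKernel n s lam rho K) (hlam : 0 < lam) (hs : 0 ≤ s)
    {z : EuclideanSpace ℝ (Fin n)} (hz : z ≠ 0) {t : ℝ} (hzt : ‖z‖ < t)
    (ht : ENNReal.ofReal t ≤ rho) :
    1 ≤ ENNReal.ofReal (lam * t ^ ((n : ℝ) + s)) * ENNReal.ofReal (K z) := by
  have hz0 : 0 < ‖z‖ := norm_pos_iff.2 hz
  have hle : ‖z‖ ^ ((n : ℝ) + s) ≤ t ^ ((n : ℝ) + s) :=
    Real.rpow_le_rpow hz0.le hzt.le (by positivity)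
  have hlow : 1 / (lam * ‖z‖ ^ ((n : ℝ) + s)) ≤ K z := by
    refine hK.lower z hz (lt_of_lt_of_le ?_ ht)
    rw [← ofReal_norm]
    exact (ENNReal.ofReal_lt_ofReal_iff (hz0.trans hzt)).2 hzt
  have hpos : 0 < lam * ‖z‖ ^ ((n : ℝ) + s) := by positivity
  rw [← ENNReal.ofReal_mul (mul_nonneg hlam.le ((Real.rpow_nonneg hz0.le _).trans hle)),
    ENNReal.one_le_ofReal]
  calc (1 : ℝ) = (lam * ‖z‖ ^ ((n : ℝ) + s)) * (1 / (lam * ‖z‖ ^ ((n : ℝ) + s))) := by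
        field_simp
    _ ≤ (lam * t ^ ((n : ℝ) + s)) * K z := by
        refine mul_le_mul ?_ hlow (by positivity) (hpos.le.trans ?_) <;> gcongr

open Metric in
-- Points of the ball are within `2 * δ` of `x`, where the lower bound on the kernel is available
-- because `2 * δ ≤ rho`.
lemma IsKernel.volume_ball_inter_le (hK : IsKernel n s lam rho K) (hlam : 0 < lam) (hs : 0 ≤ s)
    {δ : ℝ} (hδ : ENNReal.ofReal (2 * δ) ≤ rho) {x q : EuclideanSpace ℝ (Fin n)}
    (hxq : dist x q < δ) {G : Set (EuclideanSpace ℝ (Fin n))} (hG : NullMeasurableSet G volume)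
    (hx : x ∉ G) :
    volume (ball q δ ∩ G) ≤ ENNReal.ofReal (lam * (2 * δ) ^ ((n : ℝ) + s)) *
      ∫⁻ y in G, ENNReal.ofReal (K (x - y)) := by
  rw [← lintegral_const_mul' _ _ ENNReal.ofReal_ne_top, ← setLIntegral_one]
  refine (lintegral_mono_ae ?_).trans (lintegral_mono_set inter_subset_right)
  filter_upwards [ae_restrict_mem₀ (measurableSet_ball.nullMeasurableSet.inter hG)] with y hy
  refine hK.one_le_mul hlam hs (sub_ne_zero.2 fun h => hx (by rw [h]; exact hy.2)) ?_ hδ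
  rw [← dist_eq_norm]
  have := dist_triangle_right x y q
  have := mem_ball.1 hy.1
  linarith

/-- The volume of the part of the ball `B_δ(q)` on which the characteristic function of `E`
differs from its value at `x`. -/
noncomputable def oscVolume (E : Set (EuclideanSpace ℝ (Fin n))) (δ : ℝ)
    (q : EuclideanSpace ℝ (Fin n) → EuclideanSpace ℝ (Fin n)) (x : EuclideanSpace ℝ (Fin n)) : ℝ≥0∞ :=
  E.indicator (fun x => volume (Metric.ball (q x) δ ∩ Eᶜ)) x
    + Eᶜ.indicator (fun x => volume (Metric.ball (q x) δ ∩ E)) x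

lemma lintegral_oscVolume_le [NeZero n] (hK : IsKernel n s lam rho K) (hlam : 0 < lam)
    (hs : 0 ≤ s) {δ : ℝ} (hδ : ENNReal.ofReal (2 * δ) ≤ rho)
    {p : ℕ → EuclideanSpace ℝ (Fin n)} {i : EuclideanSpace ℝ (Fin n) → ℕ} (hi : Measurable i)
    (hpi : ∀ x, dist x (p (i x)) < δ) {E : Set (EuclideanSpace ℝ (Fin n))}
    (hE : NullMeasurableSet E volume) :
    ∫⁻ x, oscVolume E δ (fun x => p (i x)) x
      ≤ ENNReal.ofReal (lam * (2 * δ) ^ ((n : ℝ) + s)) * (2 * interaction K E Eᶜ) := by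
  have hm : ∀ G : Set (EuclideanSpace ℝ (Fin n)),
      Measurable fun x => volume (Metric.ball (p (i x)) δ ∩ G) := fun G =>
    (measurable_of_countable fun j => volume (Metric.ball (p j) δ ∩ G)).comp hi
  unfold oscVolume
  rw [lintegral_add_left' ((hm _).aemeasurable.indicator₀ hE), lintegral_indicator₀ hE,
    lintegral_indicator₀ hE.compl, two_mul (interaction K E Eᶜ), mul_add]
  -- One copy of the perimeter controls the points of `E`; the other, with its arguments exchanged,
  -- controls those of `Eᶜ`.
  nth_rewrite 2 [hK.interaction_comm]
  unfold interaction
  rw [← lintegral_const_mul' _ _ ENNReal.ofReal_ne_top,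
    ← lintegral_const_mul' _ _ ENNReal.ofReal_ne_top]
  refine add_le_add (lintegral_mono_ae ?_) (lintegral_mono_ae ?_)
  · filter_upwards [ae_restrict_mem₀ hE] with x hx
    exact hK.volume_ball_inter_le hlam hs hδ (hpi x) hE.compl (not_not.2 hx)
  · filter_upwards [ae_restrict_mem₀ hE.compl] with x hx
    exact hK.volume_ball_inter_le hlam hs hδ (hpi x) hE hx

open Metric in
lemma volume_ball_le_oscVolume {E F : Set (EuclideanSpace ℝ (Fin n))} (δ : ℝ)
    (q : EuclideanSpace ℝ (Fin n) → EuclideanSpace ℝ (Fin n)) {x : EuclideanSpace ℝ (Fin n)}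
    (hx : x ∈ symmDiff E F) :
    volume (ball (q x) δ) ≤
      ‖volume.real (ball (q x) δ ∩ E) - volume.real (ball (q x) δ ∩ F)‖ₑ
        + (oscVolume E δ q x + oscVolume F δ q x) := by
  -- For `x ∈ E \ F`, the ball splits into its parts inside and outside `E`. The outside part is the
  -- oscillation of `E`, and the inside part exceeds the oscillation of `F` by at most the
  -- difference of the two averages.
  have key : ∀ {E F : Set (EuclideanSpace ℝ (Fin n))}, x ∈ E → x ∉ F →
      volume (ball (q x) δ) ≤
      ‖volume.real (ball (q x) δ ∩ E) - volume.real (ball (q x) δ ∩ F)‖ₑ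
        + (oscVolume E δ q x + oscVolume F δ q x) := by
    intro E F hxE hxF
    have hfin : ∀ G, volume (ball (q x) δ ∩ G) ≠ ∞ := fun G =>
      measure_ne_top_of_subset inter_subset_left measure_ball_lt_top.ne
    have h1 : volume (ball (q x) δ ∩ E) ≤ volume (ball (q x) δ ∩ F)
        + ‖volume.real (ball (q x) δ ∩ E) - volume.real (ball (q x) δ ∩ F)‖ₑ := by
      rw [← ofReal_measureReal (hfin E), ← ofReal_measureReal (hfin F), ← ofReal_norm,
        ← ENNReal.ofReal_add measureReal_nonneg (norm_nonneg _)]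
      refine ENNReal.ofReal_le_ofReal ?_
      have := Real.le_norm_self (volume.real (ball (q x) δ ∩ E) - volume.real (ball (q x) δ ∩ F))
      linarith
    have hEo : oscVolume E δ q x = volume (ball (q x) δ ∩ Eᶜ) := by
      simp [oscVolume, hxE]
    have hFo : oscVolume F δ q x = volume (ball (q x) δ ∩ F) := by
      simp [oscVolume, hxF]
    rw [hEo, hFo]
    calc volume (ball (q x) δ) ≤ volume (ball (q x) δ ∩ E) + volume (ball (q x) δ \ E) :=
          measure_le_inter_add_sdiff _ _ _
      _ ≤ (volume (ball (q x) δ ∩ F)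
          + ‖volume.real (ball (q x) δ ∩ E) - volume.real (ball (q x) δ ∩ F)‖ₑ)
          + volume (ball (q x) δ ∩ Eᶜ) := by gcongr; rfl
      _ = _ := by ring
  rcases hx with hx | hx
  · exact key hx.1 hx.2
  · rw [enorm_sub_rev, add_comm (oscVolume E δ q x)]
    exact key hx.1 hx.2

open Metric in
-- Integrating the pointwise bound over the symmetric difference gives this. After division by the
-- volume of the ball, of order `δ ^ n`, the perimeter term is of order `δ ^ s`.
lemma volume_ball_mul_symmDiff_le [NeZero n] (hK : IsKernel n s lam rho K) (hlam : 0 < lam)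
    (hs : 0 ≤ s) {δ : ℝ} (hδ : ENNReal.ofReal (2 * δ) ≤ rho)
    {p : ℕ → EuclideanSpace ℝ (Fin n)} {i : EuclideanSpace ℝ (Fin n) → ℕ} (hi : Measurable i)
    (hpi : ∀ x, dist x (p (i x)) < δ) {E F Ω : Set (EuclideanSpace ℝ (Fin n))}
    (hE : NullMeasurableSet E volume) (hF : NullMeasurableSet F volume)
    (hEΩ : E ⊆ Ω) (hFΩ : F ⊆ Ω) {C : ℝ≥0∞} (hEC : interaction K E Eᶜ ≤ C)
    (hFC : interaction K F Fᶜ ≤ C) :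
    volume (ball (0 : EuclideanSpace ℝ (Fin n)) δ) * volume (symmDiff E F)
      ≤ (∫⁻ x in Ω, ‖volume.real (ball (p (i x)) δ ∩ E) - volume.real (ball (p (i x)) δ ∩ F)‖ₑ)
        + ENNReal.ofReal (lam * (2 * δ) ^ ((n : ℝ) + s)) * (4 * C) := by
  have hsub : symmDiff E F ⊆ Ω := symmDiff_subset_union.trans (union_subset hEΩ hFΩ)
  have hm : ∀ G : Set (EuclideanSpace ℝ (Fin n)),
      Measurable fun x => volume (Metric.ball (p (i x)) δ ∩ G) := fun G =>
    (measurable_of_countable fun j => volume (Metric.ball (p j) δ ∩ G)).comp hi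
  have hb : Measurable fun x =>
      ‖volume.real (ball (p (i x)) δ ∩ E) - volume.real (ball (p (i x)) δ ∩ F)‖ₑ :=
    (measurable_of_countable fun j =>
      ‖volume.real (ball (p j) δ ∩ E) - volume.real (ball (p j) δ ∩ F)‖ₑ).comp hi
  have hEm : AEMeasurable (oscVolume E δ fun x => p (i x)) volume :=
    ((hm _).aemeasurable.indicator₀ hE).add ((hm _).aemeasurable.indicator₀ hE.compl)
  calc volume (ball (0 : EuclideanSpace ℝ (Fin n)) δ) * volume (symmDiff E F)
      = ∫⁻ x in symmDiff E F, volume (ball (p (i x)) δ) := by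
        simp only [Measure.addHaar_ball_center]
        rw [setLIntegral_const]
    _ ≤ ∫⁻ x in symmDiff E F,
          (‖volume.real (ball (p (i x)) δ ∩ E) - volume.real (ball (p (i x)) δ ∩ F)‖ₑ
          + (oscVolume E δ (fun x => p (i x)) x + oscVolume F δ (fun x => p (i x)) x)) := by
        refine lintegral_mono_ae ?_
        filter_upwards [ae_restrict_mem₀ ((hE.diff hF).union (hF.diff hE))] with x hx
        exact volume_ball_le_oscVolume δ (fun x => p (i x)) hx
    _ ≤ (∫⁻ x in Ω, ‖volume.real (ball (p (i x)) δ ∩ E) - volume.real (ball (p (i x)) δ ∩ F)‖ₑ)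
          + ((∫⁻ x, oscVolume E δ (fun x => p (i x)) x)
            + ∫⁻ x, oscVolume F δ (fun x => p (i x)) x) := by
        rw [lintegral_add_left hb, lintegral_add_left' hEm.restrict]
        gcongr <;> exact Measure.restrict_le_self
    _ ≤ _ := by
        gcongr
        calc _ ≤ ENNReal.ofReal (lam * (2 * δ) ^ ((n : ℝ) + s)) * (2 * C)
              + ENNReal.ofReal (lam * (2 * δ) ^ ((n : ℝ) + s)) * (2 * C) := by
              refine add_le_add ?_ ?_
              · refine (lintegral_oscVolume_le hK hlam hs hδ hi hpi hE).trans ?_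
                gcongr
              · refine (lintegral_oscVolume_le hK hlam hs hδ hi hpi hF).trans ?_
                gcongr
          _ = _ := by ring

lemma tendsto_lintegral_enorm_sub_prod {α : Type*} [MeasurableSpace α] {μ : Measure α}
    [IsFiniteMeasure μ] {f : ℕ → α → ℝ} {g : α → ℝ} {B : ℝ} (hf : ∀ k, Measurable (f k))
    (hB : ∀ k x, f k x ∈ Icc 0 B) (hfg : ∀ x, Tendsto (fun k => f k x) atTop (𝓝 (g x))) :
    Tendsto (fun kl : ℕ × ℕ => ∫⁻ x, ‖f kl.1 x - f kl.2 x‖ₑ ∂μ) (atTop ×ˢ atTop) (𝓝 0) := by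
  rw [← lintegral_zero (μ := μ)]
  refine tendsto_lintegral_filter_of_dominated_convergence (fun _ => ENNReal.ofReal B)
    (.of_forall fun kl => ((hf _).sub (hf _)).enorm) (.of_forall fun kl => .of_forall fun x => ?_)
    ?_ (.of_forall fun x => ?_)
  · rw [← ofReal_norm, Real.norm_eq_abs]
    refine ENNReal.ofReal_le_ofReal (abs_le.2 ?_)
    have h1 := hB kl.1 x
    have h2 := hB kl.2 x
    constructor <;> linarith [h1.1, h1.2, h2.1, h2.2]
  · simpa using ENNReal.mul_ne_top ENNReal.ofReal_ne_top (measure_ne_top μ univ)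
  · have := (((hfg x).comp tendsto_fst).sub ((hfg x).comp tendsto_snd)).enorm
    simpa using this

open Metric TopologicalSpace in
/-- Compactness: a sequence of subsets of a set of finite volume whose nonlocal perimeters are
bounded has a subsequence that converges almost everywhere. -/
lemma IsKernel.exists_subseq_ae_eventually_mem_or [NeZero n] (hK : IsKernel n s lam rho K)
    (hlam : 0 < lam) (hs : 0 < s) (hrho : 0 < rho) {Ω : Set (EuclideanSpace ℝ (Fin n))}
    (hΩ : volume Ω ≠ ∞) {E : ℕ → Set (EuclideanSpace ℝ (Fin n))}
    (hE : ∀ k, NullMeasurableSet (E k) volume) (hEΩ : ∀ k, E k ⊆ Ω) {C : ℝ≥0∞} (hC : C ≠ ∞)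
    (hEC : ∀ k, interaction K (E k) (E k)ᶜ ≤ C) :
    ∃ φ : ℕ → ℕ, StrictMono φ ∧
      ∀ᵐ x, (∀ᶠ k in atTop, x ∈ E (φ k)) ∨ (∀ᶠ k in atTop, x ∉ E (φ k)) := by
  let p := denseSeq (EuclideanSpace ℝ (Fin n))
  let δ : ℕ → ℝ := fun j => 1 / ((j : ℝ) + 1)
  have hδ : ∀ j, 0 < δ j := fun j => by positivity
  have hδ0 : Tendsto δ atTop (𝓝 0) := tendsto_one_div_add_atTop_nhds_zero_nat
  let b : ℕ → ℕ × ℕ → ℝ := fun k a => volume.real (ball (p a.1) (δ a.2) ∩ E k)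
  have hb : ∀ k a, b k a ∈ Icc 0 (volume.real (ball (0 : EuclideanSpace ℝ (Fin n)) (δ a.2))) := by
    refine fun k a => ⟨measureReal_nonneg, ?_⟩
    rw [Measure.real, ← Measure.addHaar_ball_center volume (p a.1)]
    exact measureReal_mono inter_subset_left measure_ball_lt_top.ne
  -- The diagonal argument: a countable product of compact intervals is sequentially compact, so all
  -- ball volumes converge along one subsequence.
  obtain ⟨L, -, ψ, hψ, hL⟩ := (isCompact_univ_pi fun a : ℕ × ℕ => isCompact_Icc (a := (0 : ℝ))
    (b := volume.real (ball (0 : EuclideanSpace ℝ (Fin n)) (δ a.2)))).tendsto_subseq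
      (x := b) fun k a _ => hb k a
  rw [tendsto_pi_nhds] at hL
  suffices hcauchy : ∀ ε : ℝ≥0∞, ε ≠ 0 → ∃ N, ∀ k ≥ N, ∀ l ≥ N,
      volume (symmDiff (E (ψ k)) (E (ψ l))) ≤ ε by
    obtain ⟨φ, hφ, hφE⟩ := NonlocalCapillarity.exists_subseq_ae_eventually_mem_or hcauchy
    exact ⟨ψ ∘ φ, hψ.comp hφ, hφE⟩
  intro ε hε
  set v := volume (ball (0 : EuclideanSpace ℝ (Fin n)) 1)
  have hv0 : v ≠ 0 := (measure_ball_pos _ _ one_pos).ne'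
  have hv : v ≠ ∞ := measure_ball_lt_top.ne
  set C' : ℝ≥0∞ := ENNReal.ofReal (lam * 2 ^ ((n : ℝ) + s)) * (4 * C)
  have hC' : C' ≠ ∞ := ENNReal.mul_ne_top ENNReal.ofReal_ne_top
    (ENNReal.mul_ne_top (by simp) hC)
  have hlim1 : Tendsto (fun j => ENNReal.ofReal (δ j ^ s) * C') atTop (𝓝 0) := by
    have h := (Real.continuousAt_rpow_const 0 s (Or.inr hs.le)).tendsto.comp hδ0
    rw [Real.zero_rpow hs.ne'] at h
    simpa using ENNReal.Tendsto.mul_const (ENNReal.tendsto_ofReal h) (Or.inr hC')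
  have hlim2 : Tendsto (fun j => ENNReal.ofReal (2 * δ j)) atTop (𝓝 0) := by
    simpa using ENNReal.tendsto_ofReal (hδ0.const_mul 2)
  have hε2 : 0 < v * (ε / 2) := by
    refine ENNReal.mul_pos hv0 ?_
    simpa using hε
  -- The scale is fixed first, independently of the sets: small enough for the perimeter error and
  -- for `2 * δ j < rho`. Only then is `N` chosen.
  obtain ⟨j, hj1, hj2⟩ := ((hlim1.eventually_lt_const hε2).and
    (hlim2.eventually_lt_const hrho)).exists
  obtain ⟨i, hi, hpi⟩ := exists_measurable_dist_denseSeq_lt (EuclideanSpace ℝ (Fin n)) (hδ j)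
  have : IsFiniteMeasure (volume.restrict Ω) := ⟨by simpa using hΩ.lt_top⟩
  have hI := tendsto_lintegral_enorm_sub_prod (μ := volume.restrict Ω)
    (f := fun k x => b (ψ k) (i x, j)) (g := fun x => L (i x, j))
    (B := volume.real (ball (0 : EuclideanSpace ℝ (Fin n)) (δ j)))
    (fun k => (measurable_of_countable fun a => b (ψ k) (a, j)).comp hi)
    (fun k x => hb (ψ k) (i x, j)) (fun x => hL (i x, j))
  set d := ENNReal.ofReal (δ j ^ n)
  have hd0 : d ≠ 0 := by simpa [d] using pow_pos (hδ j) n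
  have hd : d ≠ ∞ := ENNReal.ofReal_ne_top
  have hη : 0 < d * (v * (ε / 2)) := ENNReal.mul_pos hd0 hε2.ne'
  obtain ⟨N, hN⟩ := eventually_atTop_prod_self'.1
    (prod_atTop_atTop_eq (α := ℕ) (β := ℕ) ▸ hI.eventually_lt_const hη)
  refine ⟨N, fun k hk l hl => ?_⟩
  have hmain := volume_ball_mul_symmDiff_le hK hlam hs.le hj2.le hi hpi (hE (ψ k)) (hE (ψ l))
    (hEΩ _) (hEΩ _) (hEC _) (hEC _)
  have hpow : ENNReal.ofReal (lam * (2 * δ j) ^ ((n : ℝ) + s)) * (4 * C)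
      = d * (ENNReal.ofReal (δ j ^ s) * C') := by
    rw [Real.mul_rpow zero_le_two (hδ j).le, Real.rpow_add (hδ j) n s, Real.rpow_natCast,
      show lam * (2 ^ ((n : ℝ) + s) * (δ j ^ n * δ j ^ s))
        = δ j ^ n * (δ j ^ s * (lam * 2 ^ ((n : ℝ) + s))) by ring,
      ENNReal.ofReal_mul (by have := hδ j; positivity),
      ENNReal.ofReal_mul (by have := hδ j; positivity)]
    simp only [C', d]
    ring
  rw [hpow, Measure.addHaar_ball _ _ (hδ j).le, finrank_euclideanSpace_fin] at hmain
  have hfin : d * v * volume (symmDiff (E (ψ k)) (E (ψ l))) ≤ d * v * ε := by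
    calc _ ≤ _ := hmain
      _ ≤ d * (v * (ε / 2)) + d * (v * (ε / 2)) := by
        gcongr
        exact (hN k hk l hl).le
      _ = d * v * (ε / 2 + ε / 2) := by ring
      _ = d * v * ε := by rw [ENNReal.add_halves]
  exact (ENNReal.mul_le_mul_iff_right (mul_ne_zero hd0 hv0) (ENNReal.mul_ne_top hd hv)).1 hfin

/-! ### Passage to the limit in volume, wetting and potential -/

lemma tendsto_measure_of_ae_eventually_iff {α : Type*} [MeasurableSpace α] {μ : Measure α}
    {E : ℕ → Set α} {E' Ω : Set α} (hE : ∀ k, NullMeasurableSet (E k) μ)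
    (hE' : NullMeasurableSet E' μ) (hΩm : NullMeasurableSet Ω μ) (hΩ : μ Ω ≠ ∞)
    (hEΩ : ∀ k, E k ⊆ Ω) (h : ∀ᵐ x ∂μ, ∀ᶠ k in atTop, x ∈ E k ↔ x ∈ E') :
    Tendsto (fun k => μ (E k)) atTop (𝓝 (μ E')) := by
  rw [← lintegral_indicator_one₀ hΩm] at hΩ
  simp only [fun k => (lintegral_indicator_one₀ (hE k)).symm, ← lintegral_indicator_one₀ hE']
  refine tendsto_lintegral_of_dominated_convergence' _
    (fun k => aemeasurable_const.indicator₀ (hE k)) (fun k => .of_forall fun x =>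
      indicator_le_indicator_of_subset (hEΩ k) (fun _ => zero_le) x) hΩ ?_
  filter_upwards [h] with x hx
  refine tendsto_const_nhds.congr' ?_
  filter_upwards [hx] with k hk
  by_cases hxE : x ∈ E' <;> simp [hxE, hk]

lemma tendsto_setIntegral_of_ae_eventually_iff {α : Type*} [MeasurableSpace α] {μ : Measure α}
    {E : ℕ → Set α} {E' Ω : Set α} {g : α → ℝ} (hg : IntegrableOn g Ω μ)
    (hE : ∀ k, NullMeasurableSet (E k) μ)
    (hE' : NullMeasurableSet E' μ) (hEΩ : ∀ k, E k ⊆ Ω) (hE'Ω : E' ⊆ Ω)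
    (h : ∀ᵐ x ∂μ, ∀ᶠ k in atTop, x ∈ E k ↔ x ∈ E') :
    Tendsto (fun k => ∫ x in E k, g x ∂μ) atTop (𝓝 (∫ x in E', g x ∂μ)) := by
  have key : ∀ {F : Set α}, NullMeasurableSet F μ → F ⊆ Ω →
      ∫ x in F, g x ∂μ = ∫ x in Ω, F.indicator g x ∂μ := by
    intro F hF hFΩ
    have hF' := hF.mono_ac (Measure.absolutelyContinuous_of_le (Measure.restrict_le_self (s := Ω)))
    rw [integral_indicator₀ hF', Measure.restrict_restrict₀ hF', inter_eq_left.2 hFΩ]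
  simp only [fun k => key (hE k) (hEΩ k), key hE' hE'Ω]
  refine tendsto_integral_of_dominated_convergence (fun x => ‖g x‖)
    (fun k => hg.aestronglyMeasurable.indicator₀ ((hE k).mono_ac
      (Measure.absolutelyContinuous_of_le Measure.restrict_le_self))) hg.norm
    (fun k => .of_forall fun x => norm_indicator_le_norm_self _ _) (ae_restrict_of_ae ?_)
  filter_upwards [h] with x hx
  refine tendsto_const_nhds.congr' ?_
  filter_upwards [hx] with k hk
  by_cases hxE : x ∈ E' <;> simp [hxE, hk]

/-- The part of the capillarity functional that is a real number: the wetting energy plus the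
potential energy. -/
noncomputable def wettingPotential (K₂ : EuclideanSpace ℝ (Fin n) → ℝ)
    (Ω : Set (EuclideanSpace ℝ (Fin n))) (σ : ℝ) (g : EuclideanSpace ℝ (Fin n) → ℝ)
    (E : Set (EuclideanSpace ℝ (Fin n))) : ℝ :=
  σ * (interaction K₂ E Ωᶜ).toReal + ∫ x in E, g x

section

variable {K₁ K₂ : EuclideanSpace ℝ (Fin n) → ℝ} {Ω E : Set (EuclideanSpace ℝ (Fin n))} {σ m : ℝ}
  {g : EuclideanSpace ℝ (Fin n) → ℝ}

lemma capillarity_eq_add_wettingPotential (hK₂ : AEMeasurable K₂ volume)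
    (hper : interaction K₂ Ω Ωᶜ ≠ ∞) (hE : E ⊆ Ω) :
    capillarity K₁ K₂ Ω σ g E
      = (interaction K₁ E (Eᶜ ∩ Ω) : EReal) + (wettingPotential K₂ Ω σ g E : EReal) := by
  have hfin : interaction K₂ E Ωᶜ ≠ ∞ :=
    ne_top_of_le_ne_top hper (interaction_mono hK₂ hE Subset.rfl)
  unfold capillarity energy wettingPotential
  rw [← EReal.coe_ennreal_toReal hfin, ← EReal.coe_mul, add_assoc, ← EReal.coe_add]

lemma abs_wettingPotential_le (hK₂ : AEMeasurable K₂ volume)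
    (hper : interaction K₂ Ω Ωᶜ ≠ ∞) (hg : IntegrableOn g Ω) (hE : E ⊆ Ω) :
    |wettingPotential K₂ Ω σ g E|
      ≤ |σ| * (interaction K₂ Ω Ωᶜ).toReal + ∫ x in Ω, ‖g x‖ := by
  refine (abs_add_le _ _).trans (add_le_add ?_ ?_)
  · rw [abs_mul, abs_of_nonneg ENNReal.toReal_nonneg]
    exact mul_le_mul_of_nonneg_left
      (ENNReal.toReal_mono hper (interaction_mono hK₂ hE Subset.rfl)) (abs_nonneg σ)
  · refine (norm_integral_le_integral_norm g).trans ?_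
    exact setIntegral_mono_set hg.norm (.of_forall fun x => norm_nonneg _) (.of_forall hE)

lemma tendsto_wettingPotential (hK₂ : AEMeasurable K₂ volume)
    (hper : interaction K₂ Ω Ωᶜ ≠ ∞) (hg : IntegrableOn g Ω) (hΩ : NullMeasurableSet Ω volume)
    {F : ℕ → Set (EuclideanSpace ℝ (Fin n))} (hF : ∀ k, NullMeasurableSet (F k) volume)
    (hE : NullMeasurableSet E volume) (hFΩ : ∀ k, F k ⊆ Ω) (hEΩ : E ⊆ Ω)
    (h : ∀ᵐ x, ∀ᶠ k in atTop, x ∈ F k ↔ x ∈ E) :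
    Tendsto (fun k => wettingPotential K₂ Ω σ g (F k)) atTop
      (𝓝 (wettingPotential K₂ Ω σ g E)) := by
  have hfin : interaction K₂ E Ωᶜ ≠ ∞ :=
    ne_top_of_le_ne_top hper (interaction_mono hK₂ hEΩ Subset.rfl)
  exact (((ENNReal.tendsto_toReal hfin).comp
    (tendsto_interaction_left hK₂ hF hE hΩ.compl hΩ hper hFΩ h)).const_mul σ).add
    (tendsto_setIntegral_of_ae_eventually_iff hg hF hE hFΩ hEΩ h)

/-! ### Compactness and nonemptiness of the class of competitors -/

/-- The compactness and closure part of the direct method: a sequence of competitors with bounded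
interaction energy has a subsequence that converges almost everywhere to a competitor. -/
lemma IsKernel.exists_subseq_tendsto_competitor [NeZero n] (hK : IsKernel n s lam rho K)
    (hlam : 0 < lam) (hs : 0 < s) (hrho : 0 < rho) (hΩ : NullMeasurableSet Ω volume)
    (hΩfin : volume Ω ≠ ∞) (hper : interaction K Ω Ωᶜ ≠ ∞)
    {F : ℕ → Set (EuclideanSpace ℝ (Fin n))} (hF : ∀ k, F k ∈ competitors Ω m) {B : ℝ≥0∞}
    (hB : B ≠ ∞) (hFB : ∀ k, interaction K (F k) ((F k)ᶜ ∩ Ω) ≤ B) :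
    ∃ φ : ℕ → ℕ, StrictMono φ ∧ ∃ E ∈ competitors Ω m,
      ∀ᵐ x, ∀ᶠ k in atTop, x ∈ F (φ k) ↔ x ∈ E := by
  obtain ⟨φ, hφ, hconv⟩ := hK.exists_subseq_ae_eventually_mem_or hlam hs hrho hΩfin
    (fun k => (hF k).1) (fun k => (hF k).2.1) (C := B + interaction K Ω Ωᶜ)
    (ENNReal.add_ne_top.2 ⟨hB, hper⟩) fun k => by
      have hsub : (F k)ᶜ ⊆ ((F k)ᶜ ∩ Ω) ∪ Ωᶜ := fun x hx => by
        by_cases hxΩ : x ∈ Ω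
        · exact Or.inl ⟨hx, hxΩ⟩
        · exact Or.inr hxΩ
      calc interaction K (F k) (F k)ᶜ ≤ interaction K (F k) (((F k)ᶜ ∩ Ω) ∪ Ωᶜ) :=
            interaction_mono hK.aemeasurable Subset.rfl hsub
        _ ≤ interaction K (F k) ((F k)ᶜ ∩ Ω) + interaction K (F k) Ωᶜ :=
            interaction_union_right_le hK.aemeasurable _ _ _
        _ ≤ _ := add_le_add (hFB k) (interaction_mono hK.aemeasurable (hF k).2.1 Subset.rfl)
  -- The limit is taken to be the set-theoretic lower limit, which is measurable and contained in
  -- `Ω` everywhere, not just almost everywhere.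
  let E : Set (EuclideanSpace ℝ (Fin n)) := {x | ∀ᶠ k in atTop, x ∈ F (φ k)}
  have hEm : NullMeasurableSet E volume := by
    have : E = ⋃ N, ⋂ k, ⋂ (_ : N ≤ k), F (φ k) := by
      ext x
      simp [E]
    rw [this]
    exact .iUnion fun N => .iInter fun k => .iInter fun _ => (hF (φ k)).1
  have hEΩ : E ⊆ Ω := fun x hx => by
    obtain ⟨k, hk⟩ := hx.exists
    exact (hF (φ k)).2.1 hk
  have hiff : ∀ᵐ x, ∀ᶠ k in atTop, x ∈ F (φ k) ↔ x ∈ E := by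
    filter_upwards [hconv] with x hx
    rcases hx with hx | hx
    · filter_upwards [hx] with k hk using iff_of_true hk hx
    · filter_upwards [hx] with k hk
      refine iff_of_false hk fun hxE => ?_
      obtain ⟨l, hl, hl'⟩ := (hx.and hxE).exists
      exact hl hl'
  refine ⟨φ, hφ, E, ⟨hEm, hEΩ, ?_⟩, hiff⟩
  refine tendsto_nhds_unique (tendsto_measure_of_ae_eventually_iff (fun k => (hF (φ k)).1) hEm hΩ
    hΩfin (fun k => (hF (φ k)).2.1) hiff) ?_
  simp only [fun k => (hF (φ k)).2.2]
  exact tendsto_const_nhds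

lemma IsKernel.exists_competitor_interaction_lt_top [NeZero n] (hK : IsKernel n s lam rho K)
    (hlam : 0 ≤ lam) (hs : s < 1) (hΩ : NullMeasurableSet Ω volume)
    (hΩb : Bornology.IsBounded Ω) (hm0 : 0 ≤ m) (hm : ENNReal.ofReal m ≤ volume Ω) :
    ∃ E ∈ competitors Ω m, interaction K E (Eᶜ ∩ Ω) < ∞ := by
  obtain ⟨R, hR, hΩR⟩ := hΩb.subset_ball_lt 0 0
  obtain ⟨r, hr, hrm⟩ := exists_volume_inter_ball_eq hR.le hΩR hm0 hm
  refine ⟨Ω ∩ Metric.ball 0 r, ⟨hΩ.inter measurableSet_ball.nullMeasurableSet, inter_subset_left,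
    hrm⟩, (interaction_mono hK.aemeasurable inter_subset_right ?_).trans_lt
    (hK.interaction_ball_lt_top (R := R) hs hlam hr)⟩
  exact fun x hx => ⟨hΩR hx.2, fun hxr => hx.1 ⟨hx.2, hxr⟩⟩

end

end NonlocalCapillarity

/-! ### Existence of minimizers and finiteness of their energy -/

open NonlocalCapillarity in
theorem proposition1p1 (n : ℕ) (hn : 2 ≤ n) (s₁ s₂ lam : ℝ) (rho : ℝ≥0∞)
    (hs₁ : s₁ ∈ Set.Ioo (0 : ℝ) 1) (hs₂ : s₂ ∈ Set.Ioo (0 : ℝ) 1)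
    (hlam : 1 ≤ lam) (hrho : 0 < rho)
    (K₁ K₂ : EuclideanSpace ℝ (Fin n) → ℝ)
    (hK₁ : NonlocalCapillarity.IsKernel n s₁ lam rho K₁)
    (hK₂ : NonlocalCapillarity.IsKernel n s₂ lam rho K₂)
    (Ω : Set (EuclideanSpace ℝ (Fin n))) (hΩo : IsOpen Ω) (hΩb : Bornology.IsBounded Ω)
    (hper : NonlocalCapillarity.interaction K₁ Ω Ωᶜ
      + NonlocalCapillarity.interaction K₂ Ω Ωᶜ < ∞)
    (σ m : ℝ) (hm0 : 0 < m) (hm : ENNReal.ofReal m < volume Ω)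
    (g : EuclideanSpace ℝ (Fin n) → ℝ) (hg : MemLp g ∞ (volume.restrict Ω)) :
    (∃ E, NonlocalCapillarity.IsMinimizer K₁ K₂ Ω σ g m E) ∧
    (∀ E, NonlocalCapillarity.IsMinimizer K₁ K₂ Ω σ g m E →
      NonlocalCapillarity.interaction K₁ E (Eᶜ ∩ Ω) < ∞) := by
  have : NeZero n := ⟨by omega⟩
  have hlam0 : 0 < lam := one_pos.trans_le hlam
  obtain ⟨hper₁, hper₂⟩ := ENNReal.add_ne_top.1 hper.ne
  have hΩm : NullMeasurableSet Ω volume := hΩo.measurableSet.nullMeasurableSet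
  have hΩfin : volume Ω ≠ ∞ := hΩb.measure_lt_top.ne
  have : IsFiniteMeasure (volume.restrict Ω) := ⟨by simpa using hΩfin.lt_top⟩
  have hgi : IntegrableOn g Ω := hg.integrable le_top
  obtain ⟨E₀, hE₀, hE₀fin⟩ := hK₁.exists_competitor_interaction_lt_top hlam0.le hs₁.2 hΩm hΩb
    hm0.le hm.le
  have hcap : ∀ {E}, E ∈ competitors Ω m → capillarity K₁ K₂ Ω σ g E
      = (interaction K₁ E (Eᶜ ∩ Ω) : EReal) + (wettingPotential K₂ Ω σ g E : EReal) := fun hE =>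
    capillarity_eq_add_wettingPotential hK₂.aemeasurable hper₂ hE.2.1
  refine ⟨?_, fun E hE => ?_⟩
  · set M := |σ| * (interaction K₂ Ω Ωᶜ).toReal + ∫ x in Ω, ‖g x‖
    -- The shift by `M` makes the bounded part nonnegative, so the minimization takes place in
    -- `ℝ≥0∞`.
    let Φ : Set (EuclideanSpace ℝ (Fin n)) → ℝ≥0∞ := fun E =>
      interaction K₁ E (Eᶜ ∩ Ω) + ENNReal.ofReal (M + wettingPotential K₂ Ω σ g E)
    have hΦ : ∀ {E}, E ∈ competitors Ω m →
        capillarity K₁ K₂ Ω σ g E = (Φ E : EReal) + ((-M : ℝ) : EReal) := by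
      intro E hE
      have hnn : 0 ≤ M + wettingPotential K₂ Ω σ g E := by
        have := (abs_le.1 (abs_wettingPotential_le (σ := σ) hK₂.aemeasurable hper₂ hgi hE.2.1)).1
        linarith
      rw [hcap hE, EReal.coe_ennreal_add, EReal.coe_ennreal_ofReal, max_eq_left hnn, add_assoc,
        ← EReal.coe_add, show M + wettingPotential K₂ Ω σ g E + -M
          = wettingPotential K₂ Ω σ g E by ring]
    obtain ⟨u, hu, hulim, huΦ⟩ := exists_seq_tendsto_sInf
      (S := Φ '' competitors Ω m) ⟨_, E₀, hE₀, rfl⟩ (OrderBot.bddBelow _)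
    choose F hF hFu using huΦ
    have hinf : sInf (Φ '' competitors Ω m) < ∞ :=
      (sInf_le (mem_image_of_mem Φ hE₀)).trans_lt
        (ENNReal.add_lt_top.2 ⟨hE₀fin, ENNReal.ofReal_lt_top⟩)
    -- Beyond `N` the antitone sequence `u` is at most `u N < ∞`, which is the uniform energy bound
    -- needed for compactness.
    obtain ⟨N, hN⟩ := (hulim.eventually_lt_const hinf).exists
    obtain ⟨φ, hφ, E, hE, hiff⟩ := hK₁.exists_subseq_tendsto_competitor hlam0 hs₁.1 hrho hΩm
      hΩfin hper₁ (F := fun k => F (k + N)) (fun k => hF _) hN.ne fun k =>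
        (le_self_add.trans (hFu (k + N)).le).trans (hu (Nat.le_add_left N k))
    have hlsc := interaction_le_liminf hK₁.aemeasurable (E := fun k => F (φ k + N))
      (F := fun k => (F (φ k + N))ᶜ ∩ Ω) (E' := E) (F' := Eᶜ ∩ Ω) (fun k => (hF _).1)
      (fun k => (hF _).1.compl.inter hΩm) hE.1 (hE.1.compl.inter hΩm)
      (by filter_upwards [hiff] with x hx hxE using hx.mono fun k hk => hk.2 hxE)
      (by filter_upwards [hiff] with x hx hxE using
            hx.mono fun k hk => mem_inter (fun h => hxE.1 (hk.1 h)) hxE.2)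
    have hwet := ENNReal.tendsto_ofReal ((tendsto_wettingPotential (σ := σ) hK₂.aemeasurable hper₂
      hgi hΩm (fun k => (hF (φ k + N)).1) hE.1 (fun k => (hF _).2.1) hE.2.1 hiff).const_add M)
    have hulim' : Tendsto (fun k => Φ (F (φ k + N))) atTop
        (𝓝 (sInf (Φ '' competitors Ω m))) := by
      simp only [hFu]
      exact hulim.comp ((tendsto_add_atTop_nat N).comp hφ.tendsto_atTop)
    have hmin : Φ E ≤ sInf (Φ '' competitors Ω m) := by
      -- Since both the total and the finite wetting part converge, so does their difference `I₁`;
      -- its limit is thus the lower limit bounding `I₁` of `E`.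
      have hI := ENNReal.Tendsto.sub hulim' hwet (Or.inr ENNReal.ofReal_ne_top)
      simp only [Φ, ENNReal.add_sub_cancel_right ENNReal.ofReal_ne_top] at hI
      calc Φ E ≤ _ := add_le_add_left (hlsc.trans hI.liminf_eq.le) _
        _ = _ := tsub_add_cancel_of_le
          (le_of_tendsto_of_tendsto' hwet hulim' fun k => le_add_self)
    refine ⟨E, hE, fun G hG => ?_⟩
    rw [hΦ hE, hΦ hG]
    gcongr
    exact_mod_cast hmin.trans (sInf_le (mem_image_of_mem Φ hG))
  · have hle := hE.2 E₀ hE₀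
    -- If `I₁` were infinite, the functional would be `⊤` at `E`, yet at most its finite value at
    -- `E₀`.
    rw [hcap hE.1, hcap hE₀] at hle
    by_contra hinf
    rw [not_lt_top_iff.1 hinf, EReal.coe_ennreal_top, EReal.top_add_coe, top_le_iff,
      ← EReal.coe_ennreal_toReal hE₀fin.ne, ← EReal.coe_add] at hle
    exact EReal.coe_ne_top _ hle
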